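/- Let $n,m,d\ge 0$ be integers, and let $p=(p_1,\dots,p_n)$ and $q=(q_1,\dots,q_m)$ be two configurations of points in $\mathbb R^d$. Let $(K(n,m),(p,q))$ be the associated complete bipartite framework: the complete bipartite graph $K(n,m)$ with the vertices of its first part placed at $p_1,\dots,p_n$ and those of its second part at $q_1,\dots,q_m$. For $x\in\mathbb R^d$ let $\hat x\in\mathbb R^{d+1}$ denote $x$ with a $1$ added as the last coordinate. Suppose that the affine span of $\{p_1,\dots,p_n,q_1,\dots,q_m\}$ has dimension at most $n+m-2$, and that $p$ and $q$ are strictly separated by a quadric, that is, there is a real symmetric $(d+1)\times(d+1)$ matrix $A$ with $$\hat q_j^{\,t}A\hat q_j<0<\hat p_i^{\,t}A\hat p_i\qquad (1\le i\le n,\ 1\le j\le m).$$ Then $(K(n,m),(p,q))$ is not universally rigid. Here a framework $(G,c)$ in $\mathbb R^d$ is universally rigid if, for every $D\ge 0$, every configuration $c'$ of the vertices of $G$ in $\mathbb R^D$ with $|c'_u-c'_v|=|c_u-c_v|$ for all edges $uv$ of $G$ is congruent to $c$, i.e. satisfies $|c'_u-c'_v|=|c_u-c_v|$ for all pairs of vertices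 $u,v$. -/

import Mathlib

open scoped Matrix

/-- A framework `(G, c)` in `ℝ^d` is universally rigid if, in every dimension `D`, every framework
of the same graph in `ℝ^D` with the same edge lengths is congruent to it. Since the two
configurations may live in different dimensions, congruence means equality of all pairwise
distances, which is Mathlib's `Congruent`. -/
def IsUniversallyRigid {V : Type*} {d : ℕ} (G : SimpleGraph V)
    (c : V → EuclideanSpace ℝ (Fin d)) : Prop :=
  ∀ (D : ℕ) (c' : V → EuclideanSpace ℝ (Fin D)),
    (∀ u v : V, G.Adj u v → dist (c' u) (c' v) = dist (c u) (c v)) → Congruent c c'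

/-- The vector `x̂ ∈ ℝ^(d+1)` obtained from `x ∈ ℝ^d` by adding a `1` as the last coordinate. -/
def hat {d : ℕ} (x : EuclideanSpace ℝ (Fin d)) : Fin (d + 1) → ℝ :=
  Fin.snoc (α := fun _ => ℝ) (fun i : Fin d => x i) 1

/-- The configurations `p` and `q` in `ℝ^d` are strictly separated by a quadric: some symmetric
matrix `A` of size `d + 1` satisfies `q̂ⱼᵗ A q̂ⱼ < 0 < p̂ᵢᵗ A p̂ᵢ` for all `i` and `j`. -/
def StrictlySeparatedByQuadric {n m d : ℕ} (p : Fin n → EuclideanSpace ℝ (Fin d))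
    (q : Fin m → EuclideanSpace ℝ (Fin d)) : Prop :=
  ∃ A : Matrix (Fin (d + 1)) (Fin (d + 1)) ℝ, A.IsSymm ∧
    (∀ j : Fin m, hat (q j) ⬝ᵥ (A *ᵥ hat (q j)) < 0) ∧
    (∀ i : Fin n, 0 < hat (p i) ⬝ᵥ (A *ᵥ hat (p i)))

/-! Let `M` have the rows p̂ᵢ, q̂ⱼ. The quadric yields a symmetric matrix S (`separationMatrix`)
vanishing on the diagonal and on every edge p–q, so replacing the Gram matrix M Mᵀ by M Mᵀ + s⁻¹S
preserves all edge lengths. Strict separation makes the new matrix positive semidefinite for large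
s, hence it is realized by a configuration. Universal rigidity would then force S = 0. But S is
positive on nonzero vectors v with vᵀM = 0, that is, on affine dependencies of the points, and the
dimension bound supplies one. -/

theorem exists_forall_neg_mul_dotProduct_self_le {k : Type*} [Fintype k] (N : Matrix k k ℝ) :
    ∃ s : ℝ, 0 < s ∧ ∀ r : k → ℝ, -(s * (r ⬝ᵥ r)) ≤ r ⬝ᵥ (N *ᵥ r) := by
  -- The summand 1 keeps the constant positive even when `N = 0`.
  refine ⟨1 + ∑ i, ∑ j, |N i j|, by positivity, fun r => ?_⟩
  have hr : ∀ i, r i ^ 2 ≤ r ⬝ᵥ r := fun i => by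
    simpa [dotProduct, sq] using
      Finset.single_le_sum (f := fun i => r i * r i) (fun j _ => mul_self_nonneg (r j))
        (Finset.mem_univ i)
  have h0 : 0 ≤ r ⬝ᵥ r := Finset.sum_nonneg fun j _ => mul_self_nonneg (r j)
  have key : ∀ i j, -(|N i j| * (r ⬝ᵥ r)) ≤ r i * (N i j * r j) := fun i j => by
    have h1 : |r i * r j| ≤ r ⬝ᵥ r := by
      rw [abs_le]
      constructor <;> nlinarith [hr i, hr j, sq_nonneg (r i + r j), sq_nonneg (r i - r j)]
    have h2 := mul_le_mul_of_nonneg_left h1 (abs_nonneg (N i j))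
    rw [← abs_mul] at h2
    linarith [neg_abs_le (N i j * (r i * r j))]
  calc -((1 + ∑ i, ∑ j, |N i j|) * (r ⬝ᵥ r))
      ≤ -((∑ i, ∑ j, |N i j|) * (r ⬝ᵥ r)) := by linarith
    _ = ∑ i, ∑ j, -(|N i j| * (r ⬝ᵥ r)) := by
      simp only [Finset.sum_neg_distrib, Finset.sum_mul]
    _ ≤ ∑ i, ∑ j, r i * (N i j * r j) :=
      Finset.sum_le_sum fun i _ => Finset.sum_le_sum fun j _ => key i j
    _ = r ⬝ᵥ (N *ᵥ r) := by simp only [dotProduct, Matrix.mulVec, Finset.mul_sum]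

section SeparationMatrix

variable {ι κ k : Type*} [Fintype k]

theorem dotProduct_mul_mul_transpose_mulVec [Fintype ι] (A : Matrix k k ℝ) (X : Matrix ι k ℝ) (z : ι → ℝ) :
    z ⬝ᵥ ((X * A * Xᵀ) *ᵥ z) = (z ᵥ* X) ⬝ᵥ (A *ᵥ (z ᵥ* X)) := by
  rw [← Matrix.mulVec_mulVec, ← Matrix.mulVec_mulVec, Matrix.mulVec_transpose,
    Matrix.dotProduct_mulVec]

theorem dotProduct_diagonal_mulVec [Fintype ι] [DecidableEq ι] (b z : ι → ℝ) :
    z ⬝ᵥ (Matrix.diagonal b *ᵥ z) = ∑ i, b i * z i ^ 2 := by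
  simp only [dotProduct, Matrix.mulVec_diagonal]
  exact Finset.sum_congr rfl fun i _ => by ring

theorem mul_mul_transpose_apply_self (A : Matrix k k ℝ) (X : Matrix ι k ℝ) (i : ι) :
    (X * A * Xᵀ) i i = X i ⬝ᵥ (A *ᵥ X i) := by
  rw [Matrix.dotProduct_mulVec]
  rfl

variable [DecidableEq ι] [DecidableEq κ]

/-- The block diagonal matrix with zero diagonal whose off-diagonal entries are `-xᵢᵗ A xᵢ'` and
`yⱼᵗ A yⱼ'`, where `xᵢ` and `yⱼ` are the rows of `X` and `Y`. -/
def separationMatrix (A : Matrix k k ℝ) (X : Matrix ι k ℝ) (Y : Matrix κ k ℝ) :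
    Matrix (ι ⊕ κ) (ι ⊕ κ) ℝ :=
  Matrix.fromBlocks
    (Matrix.diagonal (fun i => X i ⬝ᵥ (A *ᵥ X i)) - X * A * Xᵀ) 0 0
    (Y * A * Yᵀ - Matrix.diagonal (fun j => Y j ⬝ᵥ (A *ᵥ Y j)))

theorem separationMatrix_apply_self (A : Matrix k k ℝ) (X : Matrix ι k ℝ) (Y : Matrix κ k ℝ)
    (u : ι ⊕ κ) : separationMatrix A X Y u u = 0 := by
  rcases u with i | j
  · simp [separationMatrix, mul_mul_transpose_apply_self]
  · simp [separationMatrix, mul_mul_transpose_apply_self]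

theorem separationMatrix_isSymm {A : Matrix k k ℝ} (hA : A.IsSymm) (X : Matrix ι k ℝ)
    (Y : Matrix κ k ℝ) : (separationMatrix A X Y).IsSymm := by
  rw [Matrix.IsSymm, separationMatrix, Matrix.fromBlocks_transpose]
  simp [Matrix.transpose_sub, Matrix.transpose_mul, hA.eq, Matrix.mul_assoc]

variable [Fintype ι] [Fintype κ]

/-- Substituting `w ᵥ* Y = r - z ᵥ* X` in the second block cancels the term quadratic in `z ᵥ* X`
from the first. The opposite signs of the two blocks serve this purpose. -/
theorem dotProduct_separationMatrix_mulVec {A : Matrix k k ℝ} (hA : A.IsSymm)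
    (X : Matrix ι k ℝ) (Y : Matrix κ k ℝ) (z : ι → ℝ) (w : κ → ℝ) (r : k → ℝ)
    (hr : z ᵥ* X + w ᵥ* Y = r) :
    Sum.elim z w ⬝ᵥ (separationMatrix A X Y *ᵥ Sum.elim z w) =
      r ⬝ᵥ (A *ᵥ r) - 2 * ∑ i, z i * (X i ⬝ᵥ (A *ᵥ r)) + ∑ i, X i ⬝ᵥ (A *ᵥ X i) * z i ^ 2
        - ∑ j, Y j ⬝ᵥ (A *ᵥ Y j) * w j ^ 2 := by
  have hcross : ∑ i, z i * (X i ⬝ᵥ (A *ᵥ r)) = (z ᵥ* X) ⬝ᵥ (A *ᵥ r) := by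
    rw [← Matrix.dotProduct_mulVec]
    rfl
  have hcomm : ∀ a b : k → ℝ, a ⬝ᵥ (A *ᵥ b) = b ⬝ᵥ (A *ᵥ a) := fun a b => by
    rw [Matrix.dotProduct_mulVec, dotProduct_comm, ← Matrix.mulVec_transpose, hA.eq]
  have hw : w ᵥ* Y = r - z ᵥ* X := by rw [← hr]; abel
  rw [separationMatrix, Matrix.fromBlocks_mulVec, Sum.elim_comp_inl, Sum.elim_comp_inr,
    sumElim_dotProduct_sumElim]
  simp only [Matrix.zero_mulVec, add_zero, zero_add, Matrix.sub_mulVec, dotProduct_sub,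
    dotProduct_mul_mul_transpose_mulVec, dotProduct_diagonal_mulVec, hcross, hw, Matrix.mulVec_sub, sub_dotProduct]
  rw [hcomm r (z ᵥ* X)]
  ring

theorem exists_pos_smul_add_separationMatrix_posSemidef {A : Matrix k k ℝ} (hA : A.IsSymm)
    (X : Matrix ι k ℝ) (Y : Matrix κ k ℝ) (hX : ∀ i, 0 < X i ⬝ᵥ (A *ᵥ X i))
    (hY : ∀ j, Y j ⬝ᵥ (A *ᵥ Y j) < 0) :
    ∃ s : ℝ, 0 < s ∧ (s • (Matrix.fromRows X Y * (Matrix.fromRows X Y)ᵀ) +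
      separationMatrix A X Y).PosSemidef := by
  set a : ι → ℝ := fun i => X i ⬝ᵥ (A *ᵥ X i) with ha
  -- This matrix is the form in `r` left after completing the square in each `z i`; the terms in `w`
  -- are already nonnegative. Its lower bound is absorbed by `s • M Mᵀ`, whose value is `s * (r ⬝ᵥ
  -- r)`.
  obtain ⟨s, hs, hbound⟩ := exists_forall_neg_mul_dotProduct_self_le
    (A - (X * A)ᵀ * Matrix.diagonal (fun i => (a i)⁻¹) * (X * A))
  refine ⟨s, hs, Matrix.PosSemidef.of_dotProduct_mulVec_nonneg ?_ fun v => ?_⟩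
  · have h := separationMatrix_isSymm hA X Y
    rw [Matrix.IsHermitian, Matrix.conjTranspose_eq_transpose_of_trivial]
    rw [Matrix.transpose_add, Matrix.transpose_smul, Matrix.transpose_mul,
      Matrix.transpose_transpose, h.eq]
  · obtain ⟨z, w, rfl⟩ : ∃ z w, v = Sum.elim z w := ⟨v ∘ Sum.inl, v ∘ Sum.inr, by simp⟩
    set r := z ᵥ* X + w ᵥ* Y with hr
    have hM : Sum.elim z w ⬝ᵥ
        ((Matrix.fromRows X Y * (Matrix.fromRows X Y)ᵀ) *ᵥ Sum.elim z w) = r ⬝ᵥ r := by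
      rw [← Matrix.mulVec_mulVec, Matrix.mulVec_transpose, Matrix.dotProduct_mulVec,
        Matrix.sumElim_vecMul_fromRows]
    have hN : r ⬝ᵥ ((A - (X * A)ᵀ * Matrix.diagonal (fun i => (a i)⁻¹) * (X * A)) *ᵥ r) =
        r ⬝ᵥ (A *ᵥ r) - ∑ i, (X i ⬝ᵥ (A *ᵥ r)) ^ 2 / a i := by
      rw [Matrix.sub_mulVec, dotProduct_sub, ← Matrix.mulVec_mulVec, ← Matrix.mulVec_mulVec,
        Matrix.mulVec_transpose, dotProduct_comm r (_ ᵥ* _), ← Matrix.dotProduct_mulVec,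
        ← Matrix.mulVec_mulVec]
      congr 1
      simp only [dotProduct, Matrix.mulVec_diagonal]
      refine Finset.sum_congr rfl fun i _ => ?_
      change (a i)⁻¹ * (X i ⬝ᵥ (A *ᵥ r)) * (X i ⬝ᵥ (A *ᵥ r)) = (X i ⬝ᵥ (A *ᵥ r)) ^ 2 / a i
      ring
    have hsq : ∀ i, -((X i ⬝ᵥ (A *ᵥ r)) ^ 2 / a i) ≤
        -2 * (z i * (X i ⬝ᵥ (A *ᵥ r))) + a i * z i ^ 2 := fun i => by
      have hai : 0 < a i := hX i
      have h : -2 * (z i * (X i ⬝ᵥ (A *ᵥ r))) + a i * z i ^ 2 + (X i ⬝ᵥ (A *ᵥ r)) ^ 2 / a i =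
          (a i * z i - X i ⬝ᵥ (A *ᵥ r)) ^ 2 / a i := by
        field_simp
        ring
      have : 0 ≤ (a i * z i - X i ⬝ᵥ (A *ᵥ r)) ^ 2 / a i := by positivity
      linarith
    have hsum := Finset.sum_le_sum fun i (_ : i ∈ Finset.univ) => hsq i
    rw [Finset.sum_neg_distrib, Finset.sum_add_distrib, ← Finset.mul_sum] at hsum
    have hYsum : ∑ j, Y j ⬝ᵥ (A *ᵥ Y j) * w j ^ 2 ≤ 0 :=
      Finset.sum_nonpos fun j _ => mul_nonpos_of_nonpos_of_nonneg (hY j).le (sq_nonneg _)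
    have hb := hbound r
    rw [hN] at hb
    rw [star_trivial, Matrix.add_mulVec, dotProduct_add, Matrix.smul_mulVec, dotProduct_smul,
      smul_eq_mul, hM, dotProduct_separationMatrix_mulVec hA X Y z w r hr.symm]
    linarith

/-- Here `r = 0`, so only the diagonal terms survive, all with positive coefficients. -/
theorem dotProduct_separationMatrix_mulVec_pos {A : Matrix k k ℝ} (hA : A.IsSymm)
    (X : Matrix ι k ℝ) (Y : Matrix κ k ℝ) (hX : ∀ i, 0 < X i ⬝ᵥ (A *ᵥ X i))
    (hY : ∀ j, Y j ⬝ᵥ (A *ᵥ Y j) < 0) {v : ι ⊕ κ → ℝ} (hv : v ≠ 0)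
    (hker : v ᵥ* Matrix.fromRows X Y = 0) :
    0 < v ⬝ᵥ (separationMatrix A X Y *ᵥ v) := by
  obtain ⟨z, w, rfl⟩ : ∃ z w, v = Sum.elim z w := ⟨v ∘ Sum.inl, v ∘ Sum.inr, by simp⟩
  rw [Matrix.sumElim_vecMul_fromRows] at hker
  rw [dotProduct_separationMatrix_mulVec hA X Y z w 0 hker]
  have h1 : ∀ i, 0 ≤ X i ⬝ᵥ (A *ᵥ X i) * z i ^ 2 := fun i => mul_nonneg (hX i).le (sq_nonneg _)
  have h2 : ∀ j, 0 ≤ -(Y j ⬝ᵥ (A *ᵥ Y j)) * w j ^ 2 := fun j =>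
    mul_nonneg (neg_nonneg.2 (hY j).le) (sq_nonneg _)
  have e : ∑ j, -(Y j ⬝ᵥ (A *ᵥ Y j)) * w j ^ 2 = -∑ j, Y j ⬝ᵥ (A *ᵥ Y j) * w j ^ 2 := by
    simp
  have s1 := Finset.sum_nonneg fun i (_ : i ∈ Finset.univ) => h1 i
  have s2 := Finset.sum_nonneg fun j (_ : j ∈ Finset.univ) => h2 j
  obtain ⟨u, hu⟩ := Function.ne_iff.1 hv
  simp only [Matrix.mulVec_zero, dotProduct_zero, mul_zero, Finset.sum_const_zero]
  rcases u with i | j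
  · have : 0 < ∑ i, X i ⬝ᵥ (A *ᵥ X i) * z i ^ 2 :=
      Finset.sum_pos' (fun i _ => h1 i) ⟨i, Finset.mem_univ i, mul_pos (hX i) (sq_pos_of_ne_zero hu)⟩
    linarith
  · have : 0 < ∑ j, -(Y j ⬝ᵥ (A *ᵥ Y j)) * w j ^ 2 :=
      Finset.sum_pos' (fun j _ => h2 j)
        ⟨j, Finset.mem_univ j, mul_pos (neg_pos.2 (hY j)) (sq_pos_of_ne_zero hu)⟩
    linarith

end SeparationMatrix

open scoped MatrixOrder Matrix.Norms.L2Operator in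
/-- A positive semidefinite matrix is the Gram matrix of some configuration. -/
theorem Matrix.PosSemidef.exists_configuration {V : Type*} [Fintype V] {G : Matrix V V ℝ}
    (hG : G.PosSemidef) : ∃ c : V → EuclideanSpace ℝ (Fin (Fintype.card V)),
      ∀ u v, dist (c u) (c v) ^ 2 = G u u + G v v - 2 * G u v := by
  classical
  obtain ⟨B, rfl⟩ := CStarAlgebra.nonneg_iff_eq_star_mul_self.1 hG.nonneg
  let e := Fintype.equivFin V
  refine ⟨fun u => WithLp.toLp 2 fun i => B (e.symm i) u, fun u v => ?_⟩
  rw [EuclideanSpace.dist_eq, Real.sq_sqrt (by positivity)]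
  simp only [Matrix.mul_apply, Matrix.star_apply, star_trivial, Real.dist_eq, sq_abs]
  rw [e.symm.sum_comp fun i => (B i u - B i v) ^ 2, Finset.mul_sum, ← Finset.sum_add_distrib,
    ← Finset.sum_sub_distrib]
  exact Finset.sum_congr rfl fun i _ => by ring

theorem dist_sq_eq_hat_dotProduct {d : ℕ} (x y : EuclideanSpace ℝ (Fin d)) :
    dist x y ^ 2 = hat x ⬝ᵥ hat x + hat y ⬝ᵥ hat y - 2 * (hat x ⬝ᵥ hat y) := by
  rw [EuclideanSpace.dist_eq, Real.sq_sqrt (by positivity)]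
  simp only [dotProduct, Fin.sum_univ_castSucc, hat, Fin.snoc_castSucc, Fin.snoc_last,
    Real.dist_eq, sq_abs, mul_add, Finset.mul_sum]
  have : ∑ i, (x i - y i) ^ 2 = ∑ i, x i * x i + ∑ i, y i * y i - ∑ i, 2 * (x i * y i) := by
    rw [← Finset.sum_add_distrib, ← Finset.sum_sub_distrib]
    exact Finset.sum_congr rfl fun i _ => by ring
  rw [this]
  ring

/-- The appended coordinate 1 encodes that the weights sum to zero, so affine dependence becomes
linear dependence. -/
theorem exists_ne_zero_vecMul_hat_eq_zero {V : Type*} [Fintype V] {d : ℕ}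
    (c : V → EuclideanSpace ℝ (Fin d)) (hc : ¬ AffineIndependent ℝ c) :
    ∃ v : V → ℝ, v ≠ 0 ∧ v ᵥ* (fun u => hat (c u) : Matrix V (Fin (d + 1)) ℝ) = 0 := by
  classical
  rw [affineIndependent_iff] at hc
  push Not at hc
  obtain ⟨s, w, hw0, hw, u, hu, huw⟩ := hc
  refine ⟨fun x => if x ∈ s then w x else 0, fun h => huw ?_, ?_⟩
  · simpa [hu] using congrFun h u
  · ext i
    simp only [Matrix.vecMul, dotProduct, ite_mul, zero_mul, Finset.sum_ite_mem,
      Finset.univ_inter, Pi.zero_apply]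
    refine Fin.lastCases ?_ (fun i => ?_) i
    · simpa [hat] using hw0
    · simpa [hat] using congrArg (fun y : EuclideanSpace ℝ (Fin d) => y i) hw

theorem not_affineIndependent_of_finrank_direction_le {V : Type*} [Fintype V] {d : ℕ}
    (c : V → EuclideanSpace ℝ (Fin d))
    (h : (Module.finrank ℝ (affineSpan ℝ (Set.range c)).direction : ℤ) ≤ Fintype.card V - 2) :
    ¬ AffineIndependent ℝ c := fun hc => by
  have hpos : 0 < Fintype.card V := by omega
  have : Nonempty V := Fintype.card_pos_iff.1 hpos
  have := hc.finrank_vectorSpan_add_one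
  rw [direction_affineSpan] at h
  omega

theorem mainTheorem1 (n m d : ℕ) (p : Fin n → EuclideanSpace ℝ (Fin d))
    (q : Fin m → EuclideanSpace ℝ (Fin d))
    (hdim : (Module.finrank ℝ (affineSpan ℝ (Set.range (Sum.elim p q))).direction : ℤ)
      ≤ (n : ℤ) + (m : ℤ) - 2)
    (hsep : StrictlySeparatedByQuadric p q) :
    ¬ IsUniversallyRigid (completeBipartiteGraph (Fin n) (Fin m)) (Sum.elim p q) := by
  intro hrigid
  obtain ⟨A, hA, hq, hp⟩ := hsep
  let X : Matrix (Fin n) (Fin (d + 1)) ℝ := fun i => hat (p i)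
  let Y : Matrix (Fin m) (Fin (d + 1)) ℝ := fun j => hat (q j)
  have hrows : Matrix.fromRows X Y = fun u => hat (Sum.elim p q u) := by
    ext (i | j) l <;> rfl
  obtain ⟨v, hv, hker⟩ := exists_ne_zero_vecMul_hat_eq_zero _
    (not_affineIndependent_of_finrank_direction_le (Sum.elim p q) (by simpa using hdim))
  rw [← hrows] at hker
  obtain ⟨s, hs, hpsd⟩ := exists_pos_smul_add_separationMatrix_posSemidef hA X Y hp hq
  -- Scaling by `s⁻¹` restores coefficient 1 on the original Gram matrix.
  obtain ⟨c', hc'⟩ := (hpsd.smul (inv_nonneg.2 hs.le)).exists_configuration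
  have hdist : ∀ u w, dist (c' u) (c' w) ^ 2 =
      dist (Sum.elim p q u) (Sum.elim p q w) ^ 2 - 2 * (s⁻¹ * separationMatrix A X Y u w) := by
    intro u w
    have hgram : ∀ u w, (Matrix.fromRows X Y * (Matrix.fromRows X Y)ᵀ) u w =
        hat (Sum.elim p q u) ⬝ᵥ hat (Sum.elim p q w) := fun u w => by
      rw [hrows]
      rfl
    rw [hc', dist_sq_eq_hat_dotProduct]
    simp only [Matrix.smul_apply, Matrix.add_apply, smul_eq_mul, hgram,
      separationMatrix_apply_self]
    field_simp
    ring
  have hcong := hrigid _ c' fun u w huw => by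
    have h0 : separationMatrix A X Y u w = 0 := by
      rcases u with i | i <;> rcases w with j | j <;> simp_all [separationMatrix]
    have h := hdist u w
    rw [h0, mul_zero, mul_zero, sub_zero] at h
    exact (sq_eq_sq₀ dist_nonneg dist_nonneg).1 h
  have hzero : separationMatrix A X Y = 0 := by
    ext u w
    have h := hdist u w
    rw [← hcong.dist_eq u w] at h
    have h' : s⁻¹ * separationMatrix A X Y u w = 0 := by linarith
    simpa [hs.ne'] using h'
  have hpos := dotProduct_separationMatrix_mulVec_pos hA X Y hp hq hv hker
  simp [hzero] at hpos
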